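/- Let $j=\sqrt{-1}$ and let $A,E$ be real square matrices of the same size. A number $\lambda\in\mathbb{C}$ is an eigenvalue of the pencil $(A,E)$ if $\det(A-\lambda E)=0$. For $\phi\in\mathbb{R}$ let $\mathrm{wrap}(\phi)\in(-\pi,\pi]$ be the principal argument of $e^{j\phi}$. On numbers, $\log$ is the principal logarithm; for a complex square matrix $X$ without eigenvalues on the closed negative real axis $(-\infty,0]$, $\log X$ is the principal logarithm, that is, the unique matrix $Q$ with $e^Q=X$ all of whose eigenvalues lie in the strip $-\pi<\operatorname{Im}z<\pi$. Suppose that the pencil $(A,E)$ is regular, and let $\alpha,\beta\in\mathbb{C}$ be any numbers for which $\alpha E+\beta A$ is invertible. Let $\theta_1,\theta_2\in(-\pi,\pi)$, and let $[\theta_1,\theta_2]$ denote the closed interval with these endpoints (in either order). Suppose that $e^{j\phi}$ is not an eigenvalue of $(A,E)$ for any $\phi\in\mathbb{R}$ with $\mathrm{wrap}(\phi)\in[\theta_1,\theta_2]$. For $\varepsilon\in\mathbb{C}$ and $\theta\in(-\pi,\pi)$ put $$A_\varepsilon=A+\alpha\varepsilon I,\qquad E_\varepsilon=E-\beta\varepsilon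 I,\qquad \Gamma(\theta,\varepsilon)=(E_\varepsilon+A_\varepsilon)\tan(\theta/2)-j(E_\varepsilon-A_\varepsilon),\qquad \eta=\log\left(\frac{\tan(\theta_2/2)-j}{\tan(\theta_1/2)-j}\right).$$ Then $e^{j\theta}E-A$ is invertible for every $\theta\in[\theta_1,\theta_2]$ and $\theta\mapsto(e^{j\theta}E-A)^{-1}$ is integrable on $[\theta_1,\theta_2]$; for all sufficiently small $\varepsilon\neq0$ the matrices $A_\varepsilon$ and $\Gamma(\theta_1,\varepsilon)$ are invertible and the principal logarithms below exist and are unique; and $$\int_{\theta_1}^{\theta_2}(e^{j\theta}E-A)^{-1}\,d\theta=\lim_{\varepsilon\to0}\frac1j A_\varepsilon^{-1}\Big(-\eta I+\log\big(\Gamma(\theta_2,\varepsilon)\Gamma(\theta_1,\varepsilon)^{-1}\big)\Big)=\lim_{\varepsilon\to0}\frac1j\Big(-\eta I+\log\big(\Gamma(\theta_1,\varepsilon)^{-1}\Gamma(\theta_2,\varepsilon)\big)\Big)A_\varepsilon^{-1},$$ where $\varepsilon\to0$ through nonzero complex numbers. -/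

import Mathlib

open Filter Topology

noncomputable section

namespace DescriptorPencil

variable {n : Type*} [Fintype n] [DecidableEq n]

/-- A real matrix, viewed as a complex matrix. -/
def toC (M : Matrix n n ℝ) : Matrix n n ℂ := M.map (fun x : ℝ => (x : ℂ))

/-- `wrap θ` is the principal argument, in `(-π, π]`, of `e^{jθ}`. -/
def wrap (θ : ℝ) : ℝ := Complex.arg (Complex.exp (θ * Complex.I))

/-- `z` is an eigenvalue of the pencil `(A, E)`, that is, `det (A - z E) = 0`. -/
def IsEigenvalue (A E : Matrix n n ℝ) (z : ℂ) : Prop :=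
  (toC A - z • toC E).det = 0

/-- The transfer function `K(z) = (z E - A)⁻¹`. -/
def K (A E : Matrix n n ℝ) (z : ℂ) : Matrix n n ℂ :=
  (z • toC E - toC A)⁻¹

/-- The entrywise integral of `K(e^{jθ})` from `θ₁` to `θ₂`. -/
def integralK (A E : Matrix n n ℝ) (θ₁ θ₂ : ℝ) : Matrix n n ℂ :=
  Matrix.of fun i k => ∫ θ in θ₁..θ₂, K A E (Complex.exp (θ * Complex.I)) i k

/-- `Q` is a principal logarithm of `X`: `e^Q = X`, and all the eigenvalues of `Q` lie in
the open horizontal strip `-π < Im z < π`. -/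
def IsPrincipalLog (X Q : Matrix n n ℂ) : Prop :=
  NormedSpace.exp Q = X ∧ ∀ z ∈ spectrum ℂ Q, -Real.pi < z.im ∧ z.im < Real.pi

open Classical in
/-- The principal logarithm of a complex matrix. It exists, and is then unique, exactly when
the matrix has no eigenvalue on the closed negative real axis; otherwise the value is `0`. -/
def principalLog (X : Matrix n n ℂ) : Matrix n n ℂ :=
  if h : ∃ Q, IsPrincipalLog X Q then h.choose else 0

/-- `A_ε = A + α ε I`. -/
def Aeps (A : Matrix n n ℝ) (α ε : ℂ) : Matrix n n ℂ :=
  toC A + (α * ε) • (1 : Matrix n n ℂ)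

/-- `E_ε = E - β ε I`. -/
def Eeps (E : Matrix n n ℝ) (β ε : ℂ) : Matrix n n ℂ :=
  toC E - (β * ε) • (1 : Matrix n n ℂ)

/-- `Γ(θ, ε) = (E_ε + A_ε) tan(θ/2) - j (E_ε - A_ε)`. -/
def Gam (A E : Matrix n n ℝ) (α β : ℂ) (θ : ℝ) (ε : ℂ) : Matrix n n ℂ :=
  (Real.tan (θ / 2) : ℂ) • (Eeps E β ε + Aeps A α ε)
    - Complex.I • (Eeps E β ε - Aeps A α ε)

/-- `η = log ((tan(θ₂/2) - j) / (tan(θ₁/2) - j))`, with the principal logarithm. -/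
def eta (θ₁ θ₂ : ℝ) : ℂ :=
  Complex.log (((Real.tan (θ₂ / 2) : ℂ) - Complex.I) / ((Real.tan (θ₁ / 2) : ℂ) - Complex.I))

end DescriptorPencil

end

namespace DescriptorPencil

open NormedSpace MeasureTheory
open scoped Ring

/-! Put `B = A_ε`, `D = E_ε`, `t = tan (θ/2)` and `G(t) = (D + B) t - j (D - B)`, so that `Γ(θ, ε) =
G(t)`. The half-angle formula gives `G(t) = -(t + j) (e^{jθ} D - B)`, and since `dt/dθ = (1 +
t²)/2`, the logarithmic derivative `(dt/dθ) (D + B) G(t)⁻¹` equals `(dt/dθ) / (t - j) + j B (e^{jθ}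
D - B)⁻¹`. The scalar term integrates to `η`, the other one to `j B` times the wanted integral.

Although `B` and `D` need not commute, the integral of the left side is a genuine logarithm: `G(t)
G(t₁)⁻¹ = 1 + (t - t₁) C` with the single element `C = (D + B) G(t₁)⁻¹`, so everything in sight
commutes. The logarithm is principal because each eigenvalue `1 + T c` is joined to `1` by a segment
avoiding `0`, and so lies off `(-∞, 0]` (`isPrincipalLogIn_integral`). It is unique because any
logarithm commutes with `1 + T C`, hence with the integral, and commuting principal logarithms
coincide (`IsPrincipalLogIn.eq_of_commute`).

Solving for the integral requires `A_ε⁻¹`. The perturbation makes `A_ε` invertible for small `ε ≠ 0`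
(`eventually_isUnit_Aeps`), and the perturbed integrals converge by dominated convergence
(`tendsto_integralKeps`). -/

theorem commute_ringInverse_right {M₀ : Type*} [MonoidWithZero M₀] {a b : M₀} (h : Commute a b) :
    Commute a b⁻¹ʳ := by
  by_cases hb : IsUnit b
  · obtain ⟨u, rfl⟩ := hb
    rw [Ring.inverse_unit]
    exact h.units_inv_right
  · rw [Ring.inverse_non_unit _ hb]
    exact Commute.zero_right a

/-! ### Uniqueness of commuting principal logarithms -/

section BanachAlgebra

variable {𝔸 : Type*} [NormedRing 𝔸] [NormedAlgebra ℂ 𝔸]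

/-- Principal logarithms in a Banach algebra. -/
def IsPrincipalLogIn (X Q : 𝔸) : Prop :=
  exp Q = X ∧ ∀ z ∈ spectrum ℂ Q, -Real.pi < z.im ∧ z.im < Real.pi

/-- Left multiplication by `C` preserves the eigenspace of left multiplication by `Q`. The algebra
element `W` serves as a common eigenvector, reducing spectral questions to scalars. -/
theorem exists_common_eigen [FiniteDimensional ℂ 𝔸] {Q C : 𝔸} (h : Commute Q C) {z : ℂ}
    (hz : z ∈ spectrum ℂ Q) : ∃ W : 𝔸, W ≠ 0 ∧ ∃ c : ℂ, Q * W = z • W ∧ C * W = c • W := by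
  have hz' : z ∈ spectrum ℂ (Algebra.lmul ℂ 𝔸 Q) := by
    rw [spectrum.mem_iff] at hz ⊢
    intro hu
    apply hz
    rw [← Algebra.lmul_isUnit_iff (R := ℂ)]
    rwa [map_sub, AlgHom.commutes]
  rw [← Module.End.hasEigenvalue_iff_mem_spectrum] at hz'
  set V := Module.End.eigenspace (Algebra.lmul ℂ 𝔸 Q) z with hV
  have hmem : ∀ W : 𝔸, W ∈ V ↔ Q * W = z • W := fun W => by
    rw [hV, Module.End.mem_eigenspace_iff]; simp
  have hinv : ∀ W ∈ V, Algebra.lmul ℂ 𝔸 C W ∈ V := by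
    intro W hW
    rw [hmem] at hW ⊢
    simp only [Algebra.coe_lmul_eq_mul, LinearMap.mul_apply_apply]
    rw [← mul_assoc, h.eq, mul_assoc, hW, mul_smul_comm]
  have : Nontrivial V := by
    rw [Submodule.nontrivial_iff_ne_bot]
    exact hz'
  obtain ⟨c, hc⟩ := Module.End.exists_eigenvalue ((Algebra.lmul ℂ 𝔸 C).restrict hinv)
  obtain ⟨w, hw⟩ := hc.exists_hasEigenvector
  refine ⟨w, ?_, c, (hmem _).1 w.2, ?_⟩
  · simpa using hw.2
  · have := congrArg Subtype.val hw.apply_eq_smul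
    simpa using this

theorem mem_spectrum_of_mul_eq_smul {Q W : 𝔸} {z : ℂ} (hW : W ≠ 0) (h : Q * W = z • W) :
    z ∈ spectrum ℂ Q := by
  rw [spectrum.mem_iff]
  intro hu
  apply hW
  have : (algebraMap ℂ 𝔸 z - Q) * W = 0 := by
    rw [sub_mul, h, Algebra.smul_def, sub_self]
  exact (hu.mul_right_eq_zero).1 this

theorem exp_mul_eq_smul [CompleteSpace 𝔸] {Q W : 𝔸} {z : ℂ} (h : Q * W = z • W) :
    exp Q * W = Complex.exp z • W := by
  let _ : NormedAlgebra ℚ 𝔸 := NormedAlgebra.restrictScalars ℚ ℂ 𝔸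
  have h1 : SemiconjBy W (algebraMap ℂ 𝔸 z) Q := by
    rw [SemiconjBy, h, Algebra.smul_def, Algebra.commutes]
  have h2 := h1.exp_right
  rw [SemiconjBy, ← algebraMap_exp_comm, ← Complex.exp_eq_exp_ℂ] at h2
  rw [← h2, Algebra.smul_def, Algebra.commutes]

theorem ringInverse_mul_eq_smul {X W : 𝔸} {x : ℂ} (hX : IsUnit X) (h : X * W = x • W)
    (hx : x ≠ 0) : X⁻¹ʳ * W = x⁻¹ • W := by
  have : X⁻¹ʳ * (X * W) = W := by rw [← mul_assoc, Ring.inverse_mul_cancel _ hX, one_mul]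
  rw [h, mul_smul_comm] at this
  rw [← this, smul_smul, inv_mul_cancel₀ hx, one_smul, this]

/-- The difference `N` satisfies `e^N = 1`, and injectivity of the scalar exponential on the strip
forces its spectrum into `{0}`. Such an `N` vanishes. -/
theorem IsPrincipalLogIn.eq_of_commute [CompleteSpace 𝔸] [FiniteDimensional ℂ 𝔸] {X Q Q' : 𝔸}
    (hQ : IsPrincipalLogIn X Q) (hQ' : IsPrincipalLogIn X Q') (h : Commute Q Q') : Q' = Q := by
  let _ : NormedAlgebra ℚ 𝔸 := NormedAlgebra.restrictScalars ℚ ℂ 𝔸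
  set N := Q' - Q with hN
  have hNQ : Commute N Q := (h.symm.sub_left (Commute.refl Q))
  have hexp : exp N = 1 := by
    have h1 : exp (N + Q) = exp N * exp Q := exp_add_of_commute hNQ
    rw [hN, sub_add_cancel, ← hN, hQ'.1, ← hQ.1] at h1
    have hu := isUnit_exp Q
    exact (hu.mul_eq_right).1 h1.symm
  have hspec : ∀ z ∈ spectrum ℂ N, z = 0 := by
    intro z hz
    obtain ⟨W, hW, q, h1, h2⟩ := exists_common_eigen hNQ hz
    have h3 : Q' * W = (z + q) • W := by
      have : Q' = N + Q := by rw [hN, sub_add_cancel]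
      rw [this, add_mul, h1, h2, add_smul]
    have i2 := hQ.2 q (mem_spectrum_of_mul_eq_smul hW h2)
    have i3 := hQ'.2 _ (mem_spectrum_of_mul_eq_smul hW h3)
    have e2 := exp_mul_eq_smul h2
    have e3 := exp_mul_eq_smul h3
    rw [hQ.1] at e2
    rw [hQ'.1, e2] at e3
    have e4 := smul_left_injective ℂ hW e3
    have := Complex.exp_inj_of_neg_pi_lt_of_le_pi i2.1 i2.2.le i3.1 i3.2.le e4
    simpa using this
  -- `J` plays the role of `(e^N - 1) / N`: `N J = e^N - 1 = 0`, while `J` acts as the identity on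
  -- any `W` with `N W = 0`, which makes it invertible.
  set J : 𝔸 := ∫ s in (0:ℝ)..1, exp (s • N) with hJ
  have hcont : Continuous fun s : ℝ => exp (s • N) := exp_continuous.comp (by fun_prop)
  have hJN : N * J = 0 := by
    have hd : ∀ s ∈ Set.uIcc (0:ℝ) 1,
        HasDerivAt (fun s : ℝ => exp (s • N)) (N * exp (s • N)) s :=
      fun s _ => hasDerivAt_exp_smul_const' N s
    have h1 := intervalIntegral.integral_eq_sub_of_hasDerivAt hd
      ((continuous_const.mul hcont).intervalIntegrable _ _)
    have h2 := (ContinuousLinearMap.mul ℝ 𝔸 N).intervalIntegral_comp_comm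
      (hcont.intervalIntegrable (μ := volume) 0 1)
    simp only [ContinuousLinearMap.mul_apply'] at h2
    rw [hJ, ← h2, h1]
    simp [hexp]
  have hcomm : Commute J N := by
    rw [Commute, SemiconjBy, hJN, hJ]
    have h2 := ((ContinuousLinearMap.mul ℝ 𝔸).flip N).intervalIntegral_comp_comm
      (hcont.intervalIntegrable (μ := volume) 0 1)
    simp only [ContinuousLinearMap.mul_apply', ContinuousLinearMap.flip_apply] at h2
    rw [← h2, ← hJN, hJ]
    have h3 := (ContinuousLinearMap.mul ℝ 𝔸 N).intervalIntegral_comp_comm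
      (hcont.intervalIntegrable (μ := volume) 0 1)
    simp only [ContinuousLinearMap.mul_apply'] at h3
    rw [← h3]
    congr 1
    ext s
    exact ((Commute.refl N).smul_left s).exp_left.eq
  have hunit : IsUnit J := by
    by_contra hJ0
    have h0 : (0:ℂ) ∈ spectrum ℂ J := by
      rw [spectrum.mem_iff]; simpa using hJ0
    obtain ⟨W, hW, c, h1, h2⟩ := exists_common_eigen hcomm h0
    obtain rfl := hspec c (mem_spectrum_of_mul_eq_smul hW h2)
    apply hW
    have h3 := ((ContinuousLinearMap.mul ℝ 𝔸).flip W).intervalIntegral_comp_comm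
      (hcont.intervalIntegrable (μ := volume) 0 1)
    simp only [ContinuousLinearMap.mul_apply', ContinuousLinearMap.flip_apply] at h3
    rw [← hJ, h1, zero_smul] at h3
    rw [← h3]
    have : ∀ s : ℝ, exp (s • N) * W = W := by
      intro s
      have : (s • N) * W = (0:ℂ) • W := by rw [smul_mul_assoc, h2]; simp
      rw [exp_mul_eq_smul this]; simp
    simp [this]
  have : N = 0 := (hunit.mul_left_eq_zero).1 hJN
  exact sub_eq_zero.1 this

theorem commute_intervalIntegral [CompleteSpace 𝔸] {a : 𝔸} {f : ℝ → 𝔸} {u v : ℝ}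
    (h : ∀ t, Commute a (f t)) : Commute a (∫ t in u..v, f t) := by
  by_cases hf : IntervalIntegrable f volume u v
  · have h2 := ((ContinuousLinearMap.mul ℝ 𝔸).flip a).intervalIntegral_comp_comm hf
    have h3 := (ContinuousLinearMap.mul ℝ 𝔸 a).intervalIntegral_comp_comm hf
    simp only [ContinuousLinearMap.mul_apply', ContinuousLinearMap.flip_apply] at h2 h3
    rw [Commute, SemiconjBy, ← h2, ← h3]
    congr 1
    ext t
    exact (h t).eq
  · rw [intervalIntegral.integral_undef hf]
    exact Commute.zero_right a

/-- Commutativity allows factoring out `exp (q t)`, leaving only the derivative of `exp` at `0`. -/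
theorem hasDerivAt_exp_of_commute [CompleteSpace 𝔸] {q : ℝ → 𝔸} {q' : 𝔸} {t : ℝ}
    (hq : HasDerivAt q q' t) (h : ∀ s, Commute (q t) (q s)) :
    HasDerivAt (fun s => exp (q s)) (exp (q t) * q') t := by
  let _ : NormedAlgebra ℚ 𝔸 := NormedAlgebra.restrictScalars ℚ ℂ 𝔸
  have h1 : (fun s => exp (q s)) = fun s => exp (q t) * exp (q s - q t) := by
    ext s
    rw [← exp_add_of_commute ((h s).sub_right (Commute.refl _)), add_sub_cancel]
  rw [h1]
  refine HasDerivAt.const_mul _ ?_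
  have h2 : HasDerivAt (fun s => q s - q t) q' t := hq.sub_const _
  have h3 : HasFDerivAt (exp : 𝔸 → 𝔸) (1 : 𝔸 →L[ℝ] 𝔸) (q t - q t) := by
    rw [sub_self]; exact hasFDerivAt_exp_zero
  exact h3.comp_hasDerivAt t h2

end BanachAlgebra

/-! ### The scalar logarithm along a segment -/

theorem mul_mem_uIcc_zero {r t T : ℝ} (ht : t ∈ Set.uIcc 0 T) (h0 : 0 ≤ r) (h1 : r ≤ 1) :
    r * t ∈ Set.uIcc 0 T := by
  have := (convex_uIcc (𝕜 := ℝ) (0:ℝ) T) Set.left_mem_uIcc ht (a := 1 - r) (b := r)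
    (by linarith) h0 (by ring)
  simpa using this

theorem one_add_mul_mem_slitPlane {c : ℂ} {T : ℝ}
    (h : ∀ t ∈ Set.uIcc (0:ℝ) T, 1 + (t:ℂ) * c ≠ 0) {t : ℝ} (ht : t ∈ Set.uIcc 0 T) :
    1 + (t:ℂ) * c ∈ Complex.slitPlane := by
  by_contra hn
  rw [Complex.mem_slitPlane_iff, not_or, not_lt, not_not] at hn
  simp only [Complex.add_re, Complex.one_re, Complex.mul_re, Complex.ofReal_re, Complex.ofReal_im,
    zero_mul, sub_zero, Complex.add_im, Complex.one_im, Complex.mul_im, add_zero, zero_add] at hn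
  obtain ⟨hre, him⟩ := hn
  -- Off the slit plane `t c` is a real `u ≤ -1`; shrinking `t` by the factor `(-u)⁻¹ ≤ 1` lands
  -- exactly on the excluded zero of `1 + t c`.
  set u := t * c.re with hu
  have hu1 : u ≤ -1 := by linarith
  have hr1 : (-u)⁻¹ ≤ 1 := inv_le_one_of_one_le₀ (by linarith)
  have hr0 : 0 ≤ (-u)⁻¹ := inv_nonneg.2 (by linarith)
  apply h _ (mul_mem_uIcc_zero ht hr0 hr1)
  have hne : -u ≠ 0 := by linarith
  have hi : (-u)⁻¹ * u = -1 := by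
    have := inv_mul_cancel₀ hne
    linarith
  apply Complex.ext
  · simp only [Complex.add_re, Complex.one_re, Complex.mul_re, Complex.ofReal_re,
      Complex.ofReal_im, zero_mul, sub_zero, Complex.zero_re]
    rw [mul_assoc, ← hu, hi]; ring
  · simp only [Complex.add_im, Complex.one_im, Complex.mul_im, Complex.ofReal_re,
      Complex.ofReal_im, zero_mul, add_zero, zero_add, Complex.zero_im]
    rw [mul_assoc, him, mul_zero]

theorem integral_div_one_add_mul {c : ℂ} {T : ℝ}
    (h : ∀ t ∈ Set.uIcc (0:ℝ) T, 1 + (t:ℂ) * c ≠ 0) :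
    ∫ t in (0:ℝ)..T, c / (1 + (t:ℂ) * c) = Complex.log (1 + (T:ℂ) * c) := by
  have hd : ∀ t ∈ Set.uIcc (0:ℝ) T,
      HasDerivAt (fun t : ℝ => Complex.log (1 + (t:ℂ) * c)) (c / (1 + (t:ℂ) * c)) t := by
    intro t ht
    refine HasDerivAt.clog_real ?_ (one_add_mul_mem_slitPlane h ht)
    simpa using ((Complex.ofRealCLM.hasDerivAt (x := t)).mul_const c).const_add 1
  rw [intervalIntegral.integral_eq_sub_of_hasDerivAt hd]
  · simp
  · refine ContinuousOn.intervalIntegrable ?_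
    exact ContinuousOn.div continuousOn_const (by fun_prop) h

theorem continuousOn_ringInverse_comp {𝔸 X : Type*} [NormedRing 𝔸] [CompleteSpace 𝔸]
    [TopologicalSpace X] {f : X → 𝔸} {s : Set X}
    (hf : ContinuousOn f s) (hs : ∀ x ∈ s, IsUnit (f x)) :
    ContinuousOn (fun x => (f x)⁻¹ʳ) s := by
  intro x hx
  obtain ⟨u, hu⟩ := hs x hx
  exact (hu ▸ NormedRing.inverse_continuousAt u).comp_continuousWithinAt (hf x hx)

theorem commute_mul_ringInverse {𝔸 : Type*} [Ring 𝔸] [Algebra ℂ 𝔸] {a C : 𝔸}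
    (h : Commute a C) (t : ℝ) :
    Commute a (C * (1 + (t:ℂ) • C)⁻¹ʳ) :=
  h.mul_right (commute_ringInverse_right ((Commute.one_right a).add_right (h.smul_right _)))

/-! ### The principal logarithm of `1 + T C` as an integral -/

section BanachAlgebra

variable {𝔸 : Type*} [NormedRing 𝔸] [NormedAlgebra ℂ 𝔸] [CompleteSpace 𝔸]

theorem isOpen_isUnit_one_add_smul (C : 𝔸) : IsOpen {t : ℝ | IsUnit (1 + (t:ℂ) • C)} :=
  Units.isOpen.preimage (by fun_prop : Continuous fun t : ℝ => 1 + (t:ℂ) • C)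

theorem continuousOn_mul_ringInverse (C : 𝔸) :
    ContinuousOn (fun t : ℝ => C * (1 + (t:ℂ) • C)⁻¹ʳ) {t : ℝ | IsUnit (1 + (t:ℂ) • C)} :=
  continuousOn_const.mul (continuousOn_ringInverse_comp (by fun_prop) fun _ h => h)

theorem exp_integral_mul_ringInverse {C : 𝔸} {T : ℝ}
    (h : ∀ t ∈ Set.uIcc (0:ℝ) T, IsUnit (1 + (t:ℂ) • C)) :
    exp (∫ t in (0:ℝ)..T, C * (1 + (t:ℂ) • C)⁻¹ʳ) = 1 + (T:ℂ) • C := by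
  let _ : NormedAlgebra ℚ 𝔸 := NormedAlgebra.restrictScalars ℚ ℂ 𝔸
  set F : ℝ → 𝔸 := fun t => C * (1 + (t:ℂ) • C)⁻¹ʳ with hF
  set q : ℝ → 𝔸 := fun t => ∫ s in (0:ℝ)..t, F s with hq
  have hcont := continuousOn_mul_ringInverse C
  have hopen := isOpen_isUnit_one_add_smul C
  have hqd : ∀ t ∈ Set.uIcc (0:ℝ) T, HasDerivAt q (F t) t := by
    intro t ht
    refine intervalIntegral.integral_hasDerivAt_right ?_ ?_ ?_
    · refine (hcont.mono ?_).intervalIntegrable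
      intro s hs
      exact h s (Set.uIcc_subset_uIcc_left ht hs)
    · exact hcont.stronglyMeasurableAtFilter hopen t (h t ht)
    · exact hcont.continuousAt (hopen.mem_nhds (h t ht))
  have hCF : ∀ s, Commute C (F s) := commute_mul_ringInverse (Commute.refl C)
  have hCq : ∀ t, Commute C (q t) := fun t => commute_intervalIntegral hCF
  have hqq : ∀ t s, Commute (q t) (q s) := fun t s =>
    commute_intervalIntegral (commute_mul_ringInverse (hCq t).symm)
  -- Since `F t (1 + t C) = C`, the product `e^{-q(t)} (1 + t C)` has zero derivative, so it keeps
  -- its initial value `1`.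
  have hd : ∀ t ∈ Set.uIcc (0:ℝ) T,
      HasDerivWithinAt (fun t => exp (-q t) * (1 + (t:ℂ) • C)) 0 (Set.uIcc 0 T) t := by
    intro t ht
    have h1 := hasDerivAt_exp_of_commute (hqd t ht).neg
      (fun s => ((hqq t s).neg_left).neg_right)
    have h2 : HasDerivAt (fun t : ℝ => 1 + (t:ℂ) • C) C t := by
      simpa using ((Complex.ofRealCLM.hasDerivAt (x := t)).smul_const C).const_add 1
    have h3 := (h1.mul h2).hasDerivWithinAt (s := Set.uIcc 0 T)
    have h4 : F t * (1 + (t:ℂ) • C) = C := by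
      rw [hF]; simp only; rw [mul_assoc, Ring.inverse_mul_cancel _ (h t ht), mul_one]
    rwa [mul_neg, neg_mul, mul_assoc, h4, neg_add_cancel] at h3
  have h5 := Convex.norm_image_sub_le_of_norm_hasDerivWithin_le (C := 0) hd (by simp)
    (convex_uIcc (0:ℝ) T) Set.left_mem_uIcc Set.right_mem_uIcc
  rw [zero_mul, norm_le_zero_iff, sub_eq_zero] at h5
  have h6 : q 0 = 0 := by simp [hq]
  simp only [h6, neg_zero, exp_zero, Complex.ofReal_zero, zero_smul, add_zero, mul_one] at h5
  have h7 : exp (q T) * exp (-q T) = 1 := by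
    rw [← exp_add_of_commute (Commute.refl (q T)).neg_right, add_neg_cancel, exp_zero]
  calc exp (q T) = exp (q T) * (exp (-q T) * (1 + (T:ℂ) • C)) := by rw [h5, mul_one]
    _ = 1 + (T:ℂ) • C := by rw [← mul_assoc, h7, one_mul]

variable [FiniteDimensional ℂ 𝔸]

/-- On a common eigenvector with eigenvalue `c` of `C`, the integral acts as `log (1 + T c)`, whose
argument is never `π`. -/
theorem isPrincipalLogIn_integral {C : 𝔸} {T : ℝ}
    (h : ∀ t ∈ Set.uIcc (0:ℝ) T, IsUnit (1 + (t:ℂ) • C)) :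
    IsPrincipalLogIn (1 + (T:ℂ) • C) (∫ t in (0:ℝ)..T, C * (1 + (t:ℂ) • C)⁻¹ʳ) := by
  refine ⟨exp_integral_mul_ringInverse h, ?_⟩
  intro z hz
  have hcomm : Commute (∫ t in (0:ℝ)..T, C * (1 + (t:ℂ) • C)⁻¹ʳ) C :=
    (commute_intervalIntegral (commute_mul_ringInverse (Commute.refl C))).symm
  obtain ⟨W, hW, c, h1, h2⟩ := exists_common_eigen hcomm hz
  have h3 : ∀ t : ℝ, (1 + (t:ℂ) • C) * W = (1 + (t:ℂ) * c) • W := by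
    intro t
    rw [add_mul, one_mul, smul_mul_assoc, h2, add_smul, one_smul, smul_smul]
  have h4 : ∀ t ∈ Set.uIcc (0:ℝ) T, 1 + (t:ℂ) * c ≠ 0 := by
    intro t ht h0
    apply hW
    have := h3 t
    rw [h0, zero_smul] at this
    exact ((h t ht).mul_right_eq_zero).1 this
  have hint : IntervalIntegrable (fun t : ℝ => C * (1 + (t:ℂ) • C)⁻¹ʳ) volume 0 T :=
    ((continuousOn_mul_ringInverse C).mono h).intervalIntegrable
  have h5 := ((ContinuousLinearMap.mul ℝ 𝔸).flip W).intervalIntegral_comp_comm hint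
  simp only [ContinuousLinearMap.mul_apply', ContinuousLinearMap.flip_apply] at h5
  have h6 : ∫ t in (0:ℝ)..T, C * (1 + (t:ℂ) • C)⁻¹ʳ * W
      = ∫ t in (0:ℝ)..T, (c / (1 + (t:ℂ) * c)) • W := by
    refine intervalIntegral.integral_congr fun t ht => ?_
    rw [mul_assoc, ringInverse_mul_eq_smul (h t ht) (h3 t) (h4 t ht), mul_smul_comm, h2,
      smul_smul, div_eq_inv_mul]
  rw [h6, intervalIntegral.integral_smul_const, integral_div_one_add_mul h4, h1] at h5
  have h7 : z = Complex.log (1 + (T:ℂ) * c) := (smul_left_injective ℂ hW h5).symm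
  have h8 := one_add_mul_mem_slitPlane h4 Set.right_mem_uIcc
  rw [h7, Complex.log_im]
  refine ⟨Complex.neg_pi_lt_arg _, lt_of_le_of_ne (Complex.arg_le_pi _) ?_⟩
  exact Complex.slitPlane_arg_ne_pi h8

theorem IsPrincipalLogIn.eq_integral {C : 𝔸} {T : ℝ}
    (h : ∀ t ∈ Set.uIcc (0:ℝ) T, IsUnit (1 + (t:ℂ) • C)) {Q : 𝔸}
    (hQ : IsPrincipalLogIn (1 + (T:ℂ) • C) Q) :
    Q = ∫ t in (0:ℝ)..T, C * (1 + (t:ℂ) • C)⁻¹ʳ := by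
  refine (isPrincipalLogIn_integral h).eq_of_commute hQ ?_
  -- For `T ≠ 0`, `C` is recovered from `1 + T C = e^Q` and so commutes with `Q`; for `T = 0` it is
  -- not, but the integral is zero.
  rcases eq_or_ne T 0 with rfl | hT
  · simp
  · refine (commute_intervalIntegral (commute_mul_ringInverse ?_)).symm
    have h1 : Commute Q (1 + (T:ℂ) • C) := by
      rw [← hQ.1]; exact (Commute.refl Q).exp_right
    have h2 : Commute Q ((T:ℂ) • C) := by
      simpa using h1.sub_right (Commute.one_right Q)
    have h3 := h2.smul_right ((T:ℂ)⁻¹)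
    rwa [smul_smul, inv_mul_cancel₀ (by exact_mod_cast hT), one_smul] at h3

end BanachAlgebra

/-! ### The half-angle substitution and `η` -/

theorem ofReal_sub_I_ne_zero (t : ℝ) : (t:ℂ) - Complex.I ≠ 0 := by
  intro h
  have := congrArg Complex.im h
  simp at this

theorem cos_half_ne_zero {θ : ℝ} (h : θ ∈ Set.Ioo (-Real.pi) Real.pi) : Real.cos (θ / 2) ≠ 0 :=
  (Real.cos_pos_of_mem_Ioo ⟨by linarith [h.1], by linarith [h.2]⟩).ne'

/-- Both sides equal `j e^{jθ/2} / cos (θ/2)`, because `t ± j = ± j e^{∓jθ/2} / cos (θ/2)`. -/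
theorem tan_half_add_I_mul_exp {θ : ℝ} (h : Real.cos (θ / 2) ≠ 0) :
    ((Real.tan (θ / 2) : ℂ) + Complex.I) * Complex.exp (θ * Complex.I)
      = -((Real.tan (θ / 2) : ℂ) - Complex.I) := by
  have hc : Complex.cos ((θ / 2 : ℝ) : ℂ) ≠ 0 := by
    rw [← Complex.ofReal_cos]; exact_mod_cast h
  have he : Complex.exp (θ * Complex.I) = (Complex.cos ((θ / 2 : ℝ) : ℂ) +
      Complex.sin ((θ / 2 : ℝ) : ℂ) * Complex.I) ^ 2 := by
    rw [← Complex.exp_mul_I, ← Complex.exp_nat_mul]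
    congr 1; push_cast; ring
  rw [he, Complex.ofReal_tan, Complex.tan_eq_sin_div_cos]
  have h1 := Complex.sin_sq_add_cos_sq ((θ / 2 : ℝ) : ℂ)
  set s := Complex.sin ((θ / 2 : ℝ) : ℂ)
  set c := Complex.cos ((θ / 2 : ℝ) : ℂ)
  field_simp
  linear_combination (c * Complex.I * s ^ 2 + s ^ 3 + 2 * s * c ^ 2) * Complex.I_sq +
    (Complex.I * c - s) * h1

theorem hasDerivAt_tan_half {θ : ℝ} (h : Real.cos (θ / 2) ≠ 0) :
    HasDerivAt (fun θ : ℝ => Real.tan (θ / 2)) ((1 + Real.tan (θ / 2) ^ 2) / 2) θ := by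
  have h1 := (Real.hasDerivAt_tan h).comp θ ((hasDerivAt_id θ).div_const 2)
  refine h1.congr_deriv ?_
  have h2 := Real.sin_sq_add_cos_sq (θ / 2)
  rw [Real.tan_eq_sin_div_cos]
  field_simp
  linear_combination -h2

theorem continuousOn_tan_half {s : Set ℝ} (hs : s ⊆ Set.Ioo (-Real.pi) Real.pi) :
    ContinuousOn (fun θ : ℝ => Real.tan (θ / 2)) s :=
  fun _ h => (hasDerivAt_tan_half (cos_half_ne_zero (hs h))).continuousAt.continuousWithinAt

theorem uIcc_subset_Ioo {θ₁ θ₂ : ℝ} (hθ₁ : θ₁ ∈ Set.Ioo (-Real.pi) Real.pi)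
    (hθ₂ : θ₂ ∈ Set.Ioo (-Real.pi) Real.pi) :
    Set.uIcc θ₁ θ₂ ⊆ Set.Ioo (-Real.pi) Real.pi :=
  Set.ordConnected_Ioo.uIcc_subset hθ₁ hθ₂

/-- The imaginary part is `(t - u) / (u² + 1)`; it vanishes only at `t = u`, where the quotient is
`1`. Hence the principal branch in `η` needs no winding correction. -/
theorem sub_I_div_sub_I_mem_slitPlane (t u : ℝ) :
    ((t:ℂ) - Complex.I) / ((u:ℂ) - Complex.I) ∈ Complex.slitPlane := by
  have h : ((t:ℂ) - Complex.I) / ((u:ℂ) - Complex.I)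
      = (((t * u + 1) / (u ^ 2 + 1) : ℝ) : ℂ) + (((t - u) / (u ^ 2 + 1) : ℝ) : ℂ) * Complex.I := by
    have h0 : ((u:ℂ) ^ 2 + 1) ≠ 0 := by
      have : (u ^ 2 + 1 : ℝ) ≠ 0 := by positivity
      exact_mod_cast this
    rw [div_eq_iff (ofReal_sub_I_ne_zero u)]
    push_cast
    field_simp
    linear_combination ((t:ℂ) - u) * Complex.I_sq
  rw [h, Complex.mem_slitPlane_iff]
  simp only [Complex.add_re, Complex.ofReal_re, Complex.mul_re, Complex.I_re, mul_zero,
    Complex.ofReal_im, Complex.I_im, mul_one, sub_self, add_zero, Complex.add_im, Complex.mul_im,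
    zero_add]
  rcases eq_or_ne t u with rfl | htu
  · left
    exact div_pos (by nlinarith [mul_self_nonneg t]) (by positivity)
  · right
    exact div_ne_zero (sub_ne_zero.2 htu) (by positivity)

theorem continuousOn_deriv_tan_half_div {s : Set ℝ} (hs : s ⊆ Set.Ioo (-Real.pi) Real.pi) :
    ContinuousOn (fun θ : ℝ => (((1 + Real.tan (θ / 2) ^ 2) / 2 : ℝ) : ℂ) /
      ((Real.tan (θ / 2) : ℂ) - Complex.I)) s := by
  have ht := continuousOn_tan_half hs
  refine ContinuousOn.div ?_ ?_ fun θ _ => ofReal_sub_I_ne_zero _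
  · exact Complex.continuous_ofReal.comp_continuousOn
      ((continuousOn_const.add (ht.pow 2)).div_const 2)
  · exact (Complex.continuous_ofReal.comp_continuousOn ht).sub continuousOn_const

theorem integral_eq_eta {θ₁ θ₂ : ℝ} (hθ₁ : θ₁ ∈ Set.Ioo (-Real.pi) Real.pi)
    (hθ₂ : θ₂ ∈ Set.Ioo (-Real.pi) Real.pi) :
    ∫ θ in θ₁..θ₂, (((1 + Real.tan (θ / 2) ^ 2) / 2 : ℝ) : ℂ) /
      ((Real.tan (θ / 2) : ℂ) - Complex.I) = eta θ₁ θ₂ := by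
  have hsub := uIcc_subset_Ioo hθ₁ hθ₂
  have h1 := ofReal_sub_I_ne_zero (Real.tan (θ₁ / 2))
  have hd : ∀ θ ∈ Set.uIcc θ₁ θ₂, HasDerivAt (fun θ : ℝ => Complex.log
      (((Real.tan (θ / 2) : ℂ) - Complex.I) / ((Real.tan (θ₁ / 2) : ℂ) - Complex.I)))
      ((((1 + Real.tan (θ / 2) ^ 2) / 2 : ℝ) : ℂ) / ((Real.tan (θ / 2) : ℂ) - Complex.I)) θ := by
    intro θ hθ
    have h2 := (((hasDerivAt_tan_half (cos_half_ne_zero (hsub hθ))).ofReal_comp.sub_const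
      Complex.I).div_const ((Real.tan (θ₁ / 2) : ℂ) - Complex.I)).clog_real
      (sub_I_div_sub_I_mem_slitPlane _ _)
    convert h2 using 1
    rw [div_div_div_cancel_right₀ h1]
  rw [intervalIntegral.integral_eq_sub_of_hasDerivAt hd
    (continuousOn_deriv_tan_half_div hsub).intervalIntegrable]
  rw [div_self h1, Complex.log_one, sub_zero, eta]

theorem intervalIntegrable_inverse_pencil {𝔸 : Type*} [NormedRing 𝔸] [NormedAlgebra ℂ 𝔸]
    [CompleteSpace 𝔸] {θ₁ θ₂ : ℝ} {B D : 𝔸}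
    (hR : ∀ θ ∈ Set.uIcc θ₁ θ₂, IsUnit (Complex.exp (θ * Complex.I) • D - B)) :
    IntervalIntegrable (fun θ : ℝ => (Complex.exp (θ * Complex.I) • D - B)⁻¹ʳ) volume θ₁ θ₂ :=
  (continuousOn_ringInverse_comp (by fun_prop) hR).intervalIntegrable

/-! ### Algebra of the Cayley-transformed pencil -/

section Pencil

variable {𝔸 : Type*} [Ring 𝔸] [Algebra ℂ 𝔸]

/-- The matrix pencil `(D + B) t - j (D - B)` in the variable `t = tan (θ / 2)`. -/
def cayleyPencil (B D : 𝔸) (t : ℝ) : 𝔸 := (t:ℂ) • (D + B) - Complex.I • (D - B)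

theorem cayleyPencil_add (B D : 𝔸) (t u : ℝ) :
    cayleyPencil B D t = cayleyPencil B D u + ((t - u : ℝ) : ℂ) • (D + B) := by
  simp only [cayleyPencil]; push_cast; module

theorem cayleyPencil_tan_half (B D : 𝔸) {θ : ℝ} (h : Real.cos (θ / 2) ≠ 0) :
    cayleyPencil B D (Real.tan (θ / 2)) =
      (-((Real.tan (θ / 2) : ℂ) + Complex.I)) • (Complex.exp (θ * Complex.I) • D - B) := by
  have h1 := tan_half_add_I_mul_exp h
  rw [smul_sub, smul_smul, neg_mul, h1, cayleyPencil]
  module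

theorem ofReal_add_I_ne_zero (t : ℝ) : -((t:ℂ) + Complex.I) ≠ 0 := by
  intro h
  have := congrArg Complex.im h
  simp at this

theorem isUnit_cayleyPencil {B D : 𝔸} {θ : ℝ} (h : θ ∈ Set.Ioo (-Real.pi) Real.pi)
    (hu : IsUnit (Complex.exp (θ * Complex.I) • D - B)) :
    IsUnit (cayleyPencil B D (Real.tan (θ / 2))) := by
  rw [cayleyPencil_tan_half B D (cos_half_ne_zero h)]
  exact hu.smul (Units.mk0 _ (ofReal_add_I_ne_zero _))

theorem ringInverse_smul {k : ℂ} (hk : k ≠ 0) (x : 𝔸) : (k • x)⁻¹ʳ = k⁻¹ • x⁻¹ʳ := by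
  rw [Algebra.smul_def, Ring.inverse_mul (Or.inl ((isUnit_iff_ne_zero.2 hk).map _)),
    Algebra.smul_def, Algebra.commutes]
  congr 1
  exact Ring.inverse_unit ((Units.mk0 k hk).map (algebraMap ℂ 𝔸).toMonoidHom)

/-- This splits the logarithmic derivative of the pencil: the first coefficient is the integrand of
`η`, and the factor `-(t + j)` of the second cancels the one in `cayleyPencil_tan_half`. -/
theorem deriv_tan_half_smul_add (B D : 𝔸) (t : ℝ) :
    (((1 + t ^ 2) / 2 : ℝ) : ℂ) • (D + B) =
      ((((1 + t ^ 2) / 2 : ℝ) : ℂ) / ((t:ℂ) - Complex.I)) • cayleyPencil B D t +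
      (-((t:ℂ) + Complex.I) * Complex.I) • B := by
  have h1 := ofReal_sub_I_ne_zero t
  have h2 : (((1 + t ^ 2) / 2 : ℝ) : ℂ) / ((t:ℂ) - Complex.I) = ((t:ℂ) + Complex.I) / 2 := by
    rw [div_eq_iff h1]; push_cast
    linear_combination (1 / 2 : ℂ) * Complex.I_sq
  rw [h2, cayleyPencil]
  push_cast
  match_scalars
  · linear_combination (1 / 2 : ℂ) * Complex.I_sq
  · linear_combination (1 / 2 : ℂ) * Complex.I_sq

end Pencil

/-! ### The integral of the inverse pencil as a logarithm -/

section BanachAlgebra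

variable {𝔸 : Type*} [NormedRing 𝔸] [NormedAlgebra ℂ 𝔸] [CompleteSpace 𝔸]
  [FiniteDimensional ℂ 𝔸]

theorem isPrincipalLogIn_of_tan_half {θ₁ θ₂ : ℝ} (hθ₁ : θ₁ ∈ Set.Ioo (-Real.pi) Real.pi)
    (hθ₂ : θ₂ ∈ Set.Ioo (-Real.pi) Real.pi) {C : 𝔸} {S : ℝ → 𝔸}
    (hu : ∀ θ ∈ Set.uIcc θ₁ θ₂,
      IsUnit (1 + ((Real.tan (θ / 2) - Real.tan (θ₁ / 2) : ℝ) : ℂ) • C))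
    (hS : IntervalIntegrable S volume θ₁ θ₂)
    (h : ∀ θ ∈ Set.uIcc θ₁ θ₂, (((1 + Real.tan (θ / 2) ^ 2) / 2 : ℝ) : ℂ) •
        (C * (1 + ((Real.tan (θ / 2) - Real.tan (θ₁ / 2) : ℝ) : ℂ) • C)⁻¹ʳ)
      = ((((1 + Real.tan (θ / 2) ^ 2) / 2 : ℝ) : ℂ) / ((Real.tan (θ / 2) : ℂ) - Complex.I)) • 1
        + S θ) (Q : 𝔸) :
    IsPrincipalLogIn (1 + ((Real.tan (θ₂ / 2) - Real.tan (θ₁ / 2) : ℝ) : ℂ) • C) Q ↔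
      Q = eta θ₁ θ₂ • 1 + ∫ θ in θ₁..θ₂, S θ := by
  have hsub := uIcc_subset_Ioo hθ₁ hθ₂
  set g : ℝ → ℝ := fun θ => Real.tan (θ / 2) - Real.tan (θ₁ / 2) with hg
  have hgc : ContinuousOn g (Set.uIcc θ₁ θ₂) := (continuousOn_tan_half hsub).sub continuousOn_const
  have hg1 : g θ₁ = 0 := sub_self _
  have hT : ∀ t ∈ Set.uIcc (0:ℝ) (g θ₂), IsUnit (1 + (t:ℂ) • C) := by
    intro t ht
    rw [← hg1] at ht
    obtain ⟨θ, hθ, rfl⟩ := intermediate_value_uIcc hgc ht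
    exact hu θ hθ
  -- Change of variables `t = g θ`; either order of the endpoints is allowed.
  have hcv : ∫ t in (0:ℝ)..g θ₂, C * (1 + (t:ℂ) • C)⁻¹ʳ = eta θ₁ θ₂ • 1 + ∫ θ in θ₁..θ₂, S θ := by
    have h1 := intervalIntegral.integral_deriv_smul_comp' (f := g)
      (f' := fun θ => (1 + Real.tan (θ / 2) ^ 2) / 2)
      (g := fun t : ℝ => C * (1 + (t:ℂ) • C)⁻¹ʳ) (a := θ₁) (b := θ₂)
      (fun θ hθ => (hasDerivAt_tan_half (cos_half_ne_zero (hsub hθ))).sub_const _)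
      ((continuousOn_const.add ((continuousOn_tan_half hsub).pow 2)).div_const 2)
      ((continuousOn_mul_ringInverse C).mono (by rintro _ ⟨θ, hθ, rfl⟩; exact hu θ hθ))
    rw [hg1] at h1
    rw [← h1, intervalIntegral.integral_congr (g := fun θ : ℝ =>
      ((((1 + Real.tan (θ / 2) ^ 2) / 2 : ℝ) : ℂ) / ((Real.tan (θ / 2) : ℂ) - Complex.I)) •
        (1 : 𝔸) + S θ),
      intervalIntegral.integral_add _ hS, intervalIntegral.integral_smul_const,
      integral_eq_eta hθ₁ hθ₂]
    · exact ((continuousOn_deriv_tan_half_div hsub).smul continuousOn_const).intervalIntegrable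
    · intro θ hθ
      have := h θ hθ
      rw [Complex.coe_smul] at this
      exact this
  rw [← hcv]
  constructor
  · exact fun hQ => hQ.eq_integral hT
  · rintro rfl
    exact isPrincipalLogIn_integral hT

theorem isPrincipalLogIn_cayleyPencil_mul_inverse {θ₁ θ₂ : ℝ}
    (hθ₁ : θ₁ ∈ Set.Ioo (-Real.pi) Real.pi) (hθ₂ : θ₂ ∈ Set.Ioo (-Real.pi) Real.pi) {B D : 𝔸}
    (hR : ∀ θ ∈ Set.uIcc θ₁ θ₂, IsUnit (Complex.exp (θ * Complex.I) • D - B)) (Q : 𝔸) :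
    IsPrincipalLogIn (cayleyPencil B D (Real.tan (θ₂ / 2)) *
        (cayleyPencil B D (Real.tan (θ₁ / 2)))⁻¹ʳ) Q ↔
      Q = eta θ₁ θ₂ • 1 + Complex.I • (B *
        ∫ θ in θ₁..θ₂, (Complex.exp (θ * Complex.I) • D - B)⁻¹ʳ) := by
  have hsub := uIcc_subset_Ioo hθ₁ hθ₂
  have hG := fun θ hθ => isUnit_cayleyPencil (hsub hθ) (hR θ hθ)
  have hG1 := hG θ₁ Set.left_mem_uIcc
  have hint := intervalIntegrable_inverse_pencil hR
  set G := cayleyPencil B D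
  set C := (D + B) * (G (Real.tan (θ₁ / 2)))⁻¹ʳ with hC
  have hX : ∀ θ : ℝ, 1 + ((Real.tan (θ / 2) - Real.tan (θ₁ / 2) : ℝ) : ℂ) • C
      = G (Real.tan (θ / 2)) * (G (Real.tan (θ₁ / 2)))⁻¹ʳ := by
    intro θ
    rw [show G (Real.tan (θ / 2)) = _ from
      cayleyPencil_add B D (Real.tan (θ / 2)) (Real.tan (θ₁ / 2)), add_mul,
      Ring.mul_inverse_cancel _ hG1, smul_mul_assoc]
  have h2 := (ContinuousLinearMap.mul ℂ 𝔸 (Complex.I • B)).intervalIntegral_comp_comm hint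
  simp only [ContinuousLinearMap.mul_apply'] at h2
  rw [← smul_mul_assoc, ← h2, ← hX]
  refine isPrincipalLogIn_of_tan_half hθ₁ hθ₂ (fun θ hθ => ?_) (hint.const_mul _)
    (fun θ hθ => ?_) Q
  · rw [hX]; exact (hG θ hθ).mul hG1.ringInverse
  · rw [hX, Ring.inverse_mul (Or.inl (hG θ hθ)), Ring.inverse_inverse hG1, hC, mul_assoc,
      Ring.inverse_mul_cancel_left _ _ hG1, ← smul_mul_assoc, deriv_tan_half_smul_add, add_mul,
      smul_mul_assoc, Ring.mul_inverse_cancel _ (hG θ hθ)]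
    congr 1
    rw [show G (Real.tan (θ / 2)) = _ from cayleyPencil_tan_half B D (cos_half_ne_zero (hsub hθ)),
      ringInverse_smul (ofReal_add_I_ne_zero _) , mul_smul_comm, smul_mul_assoc, smul_smul,
      inv_mul_cancel_left₀ (ofReal_add_I_ne_zero _), smul_mul_assoc]

theorem isPrincipalLogIn_inverse_mul_cayleyPencil {θ₁ θ₂ : ℝ}
    (hθ₁ : θ₁ ∈ Set.Ioo (-Real.pi) Real.pi) (hθ₂ : θ₂ ∈ Set.Ioo (-Real.pi) Real.pi) {B D : 𝔸}
    (hR : ∀ θ ∈ Set.uIcc θ₁ θ₂, IsUnit (Complex.exp (θ * Complex.I) • D - B)) (Q : 𝔸) :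
    IsPrincipalLogIn ((cayleyPencil B D (Real.tan (θ₁ / 2)))⁻¹ʳ *
        cayleyPencil B D (Real.tan (θ₂ / 2))) Q ↔
      Q = eta θ₁ θ₂ • 1 + Complex.I •
        ((∫ θ in θ₁..θ₂, (Complex.exp (θ * Complex.I) • D - B)⁻¹ʳ) * B) := by
  have hsub := uIcc_subset_Ioo hθ₁ hθ₂
  have hG := fun θ hθ => isUnit_cayleyPencil (hsub hθ) (hR θ hθ)
  have hG1 := hG θ₁ Set.left_mem_uIcc
  have hint := intervalIntegrable_inverse_pencil hR
  set G := cayleyPencil B D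
  set C := (G (Real.tan (θ₁ / 2)))⁻¹ʳ * (D + B) with hC
  have hX : ∀ θ : ℝ, 1 + ((Real.tan (θ / 2) - Real.tan (θ₁ / 2) : ℝ) : ℂ) • C
      = (G (Real.tan (θ₁ / 2)))⁻¹ʳ * G (Real.tan (θ / 2)) := by
    intro θ
    rw [show G (Real.tan (θ / 2)) = _ from
      cayleyPencil_add B D (Real.tan (θ / 2)) (Real.tan (θ₁ / 2)), mul_add,
      Ring.inverse_mul_cancel _ hG1, mul_smul_comm]
  have h2 := ((ContinuousLinearMap.mul ℂ 𝔸).flip (Complex.I • B)).intervalIntegral_comp_comm hint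
  simp only [ContinuousLinearMap.mul_apply', ContinuousLinearMap.flip_apply] at h2
  rw [← mul_smul_comm, ← h2, ← hX]
  refine isPrincipalLogIn_of_tan_half hθ₁ hθ₂ (fun θ hθ => ?_) (hint.mul_const _)
    (fun θ hθ => ?_) Q
  · rw [hX]; exact hG1.ringInverse.mul (hG θ hθ)
  -- Moving `C` to the right of the inverse brings `G(t₁)` next to the `G(t₁)⁻¹` inside `C`, where
  -- they cancel.
  · have hcomm : Commute C
        (1 + ((Real.tan (θ / 2) - Real.tan (θ₁ / 2) : ℝ) : ℂ) • C)⁻¹ʳ :=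
      commute_ringInverse_right ((Commute.one_right C).add_right ((Commute.refl C).smul_right _))
    rw [hcomm.eq, hX, Ring.inverse_mul (Or.inr (hG θ hθ)), Ring.inverse_inverse hG1, hC, mul_assoc,
      Ring.mul_inverse_cancel_left _ _ hG1, ← mul_smul_comm, deriv_tan_half_smul_add, mul_add,
      mul_smul_comm, Ring.inverse_mul_cancel _ (hG θ hθ)]
    congr 1
    rw [show G (Real.tan (θ / 2)) = _ from cayleyPencil_tan_half B D (cos_half_ne_zero (hsub hθ)),
      ringInverse_smul (ofReal_add_I_ne_zero _), mul_smul_comm, smul_mul_assoc, smul_smul,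
      mul_assoc, mul_comm Complex.I, ← mul_assoc, mul_inv_cancel₀ (ofReal_add_I_ne_zero _),
      one_mul, mul_smul_comm]

end BanachAlgebra

/-! ### Stability of invertibility and of the integral -/

section Continuity

variable {𝔸 X : Type*} [NormedRing 𝔸] [CompleteSpace 𝔸] [TopologicalSpace X]

theorem eventually_forall_isUnit {f : X → ℝ → 𝔸} (hf : Continuous fun z : X × ℝ => f z.1 z.2)
    {x : X} {s : Set ℝ} (hs : IsCompact s) (hu : ∀ θ ∈ s, IsUnit (f x θ)) :
    ∀ᶠ y in 𝓝 x, ∀ θ ∈ s, IsUnit (f y θ) :=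
  hs.eventually_forall_of_forall_eventually fun θ hθ =>
    (Units.isOpen.preimage hf).mem_nhds (hu θ hθ)

theorem tendsto_integral_ringInverse [FirstCountableTopology X] [NormedSpace ℝ 𝔸] {f : X → ℝ → 𝔸}
    (hf : Continuous fun z : X × ℝ => f z.1 z.2) {x : X} {a b : ℝ}
    (hu : ∀ θ ∈ Set.uIcc a b, IsUnit (f x θ)) :
    Tendsto (fun y => ∫ θ in a..b, (f y θ)⁻¹ʳ) (𝓝 x) (𝓝 (∫ θ in a..b, (f x θ)⁻¹ʳ)) := by
  have hsec : ∀ y, Continuous (f y) := fun y => hf.comp (Continuous.prodMk_right y)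
  have hat : ∀ θ ∈ Set.uIcc a b,
      ContinuousAt (fun z : X × ℝ => (f z.1 z.2)⁻¹ʳ) (x, θ) := by
    intro θ hθ
    obtain ⟨u, hu'⟩ := hu θ hθ
    exact ContinuousAt.comp (f := fun z : X × ℝ => f z.1 z.2) (x := (x, θ))
      (hu' ▸ NormedRing.inverse_continuousAt u) hf.continuousAt
  obtain ⟨M, hM⟩ := isCompact_uIcc.exists_bound_of_continuousOn
    (continuousOn_ringInverse_comp (hsec x).continuousOn hu)
  -- Joint continuity and compactness turn the bound `M` at `x` into a uniform bound near `x`; the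
  -- slack `1` makes the inequality open.
  have hbound : ∀ᶠ y in 𝓝 x, ∀ θ ∈ Set.uIcc a b, ‖(f y θ)⁻¹ʳ‖ ≤ M + 1 := by
    refine isCompact_uIcc.eventually_forall_of_forall_eventually fun θ hθ => ?_
    have h1 : ‖(f x θ)⁻¹ʳ‖ < M + 1 := (hM θ hθ).trans_lt (lt_add_one M)
    exact ((hat θ hθ).norm.eventually_lt_const h1).mono fun _ h => h.le
  refine intervalIntegral.tendsto_integral_filter_of_dominated_convergence (fun _ => M + 1) ?_ ?_
    intervalIntegrable_const ?_
  · filter_upwards [eventually_forall_isUnit hf isCompact_uIcc hu] with y hy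
    exact (continuousOn_ringInverse_comp (hsec y).continuousOn hy).intervalIntegrable.def'.1
  · filter_upwards [hbound] with y hy
    exact Eventually.of_forall fun θ hθ => hy θ (Set.uIoc_subset_uIcc hθ)
  · refine Eventually.of_forall fun θ hθ => ?_
    exact (hat θ (Set.uIoc_subset_uIcc hθ)).tendsto.comp
      ((Continuous.prodMk_left θ).tendsto x)

end Continuity

/-! ### The perturbed matrix pencil -/

theorem continuous_perturbed_pencil {n : Type*} [DecidableEq n] (A E : Matrix n n ℝ) (α β : ℂ) :
    Continuous fun z : ℂ × ℝ =>
      Complex.exp (z.2 * Complex.I) • Eeps E β z.1 - Aeps A α z.1 := by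
  unfold Eeps Aeps
  fun_prop

variable {n : Type*} [Fintype n] [DecidableEq n]

theorem wrap_eq_self {θ : ℝ} (h : θ ∈ Set.Ioo (-Real.pi) Real.pi) : wrap θ = θ := by
  rw [wrap, Complex.arg_exp_mul_I]
  exact (toIocMod_eq_self _).2 ⟨h.1, by linarith [h.2]⟩

theorem isUnit_of_not_isEigenvalue {A E : Matrix n n ℝ} {z : ℂ} (h : ¬ IsEigenvalue A E z) :
    IsUnit (z • toC E - toC A) := by
  rw [← neg_sub, IsUnit.neg_iff, Matrix.isUnit_iff_isUnit_det]
  exact isUnit_iff_ne_zero.2 h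

/-- If `α ≠ 0`, singularity of `A_ε` means that `-αε` is one of the finitely many eigenvalues of
`A`. If `α = 0`, then `A_ε = A`, and `β A` is invertible. -/
theorem eventually_isUnit_Aeps {A E : Matrix n n ℝ} {α β : ℂ}
    (hreg : IsUnit (α • toC E + β • toC A)) : ∀ᶠ ε in 𝓝[≠] (0:ℂ), IsUnit (Aeps A α ε) := by
  rcases subsingleton_or_nontrivial (Matrix n n ℂ) with hs | hs
  · exact Eventually.of_forall fun ε => isUnit_of_subsingleton _
  rcases eq_or_ne α 0 with rfl | hα
  · refine Eventually.of_forall fun ε => ?_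
    rw [zero_smul, zero_add] at hreg
    rcases eq_or_ne β 0 with rfl | hβ
    · simp at hreg
    · have := (isUnit_smul_iff (Units.mk0 β hβ) (toC A)).1 hreg
      simpa [Aeps] using this
  · have hinj : Function.Injective fun ε : ℂ => -(α * ε) := fun x y h => by simpa [hα] using h
    have hF : ((fun ε : ℂ => -(α * ε)) ⁻¹' spectrum ℂ (toC A)).Finite :=
      (Matrix.finite_spectrum (toC A)).preimage hinj.injOn
    -- The value `ε = 0` is itself exceptional when `A` is singular, so it is removed from the
    -- finite set first.
    have h0 := (hF.subset (Set.sdiff_subset (t := {0}))).isClosed.compl_mem_nhds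
      (x := (0:ℂ)) (by simp)
    filter_upwards [mem_nhdsWithin_of_mem_nhds h0, self_mem_nhdsWithin] with ε h1 h2
    by_contra h3
    apply h1
    refine ⟨?_, h2⟩
    rw [Set.mem_preimage, spectrum.mem_iff, ← IsUnit.neg_iff]
    convert h3 using 2
    rw [Aeps, Algebra.algebraMap_eq_smul_one, neg_smul]; abel

theorem principalLog_eq {X Q : Matrix n n ℂ} (h : ∀ Q', IsPrincipalLog X Q' ↔ Q' = Q) :
    principalLog X = Q := by
  have hex : ∃ Q', IsPrincipalLog X Q' := ⟨Q, (h Q).2 rfl⟩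
  rw [principalLog, dif_pos hex]
  exact (h _).1 hex.choose_spec

theorem existsUnique_isPrincipalLog {X Q : Matrix n n ℂ}
    (h : ∀ Q', IsPrincipalLog X Q' ↔ Q' = Q) : ∃! Q', IsPrincipalLog X Q' :=
  ⟨Q, (h Q).2 rfl, fun Q' hQ' => (h Q').1 hQ'⟩

/-- The entrywise integral of the perturbed transfer function `(e^{jθ} E_ε - A_ε)⁻¹`. -/
noncomputable def integralKeps (A E : Matrix n n ℝ) (α β : ℂ) (θ₁ θ₂ : ℝ) (ε : ℂ) : Matrix n n ℂ :=
  Matrix.of fun i k => ∫ θ in θ₁..θ₂,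
    (Complex.exp (θ * Complex.I) • Eeps E β ε - Aeps A α ε)⁻¹ i k

theorem integralKeps_zero (A E : Matrix n n ℝ) (α β : ℂ) (θ₁ θ₂ : ℝ) :
    integralKeps A E α β θ₁ θ₂ 0 = integralK A E θ₁ θ₂ := by
  simp [integralKeps, integralK, K, Eeps, Aeps]

section Norm

open scoped Matrix.Norms.Operator

theorem isPrincipalLog_iff (X Q : Matrix n n ℂ) : IsPrincipalLog X Q ↔ IsPrincipalLogIn X Q :=
  Iff.rfl

theorem integralKeps_eq {A E : Matrix n n ℝ} {α β : ℂ} {θ₁ θ₂ : ℝ} {ε : ℂ}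
    (h : ∀ θ ∈ Set.uIcc θ₁ θ₂, IsUnit (Complex.exp (θ * Complex.I) • Eeps E β ε - Aeps A α ε)) :
    integralKeps A E α β θ₁ θ₂ ε = ∫ θ in θ₁..θ₂,
      (Complex.exp (θ * Complex.I) • Eeps E β ε - Aeps A α ε)⁻¹ʳ := by
  have hint := intervalIntegrable_inverse_pencil h
  simp only [← Matrix.nonsing_inv_eq_ringInverse] at hint ⊢
  refine Matrix.ext fun i k => ?_
  have h1 := (Matrix.entryLinearMap ℂ ℂ i k).toContinuousLinearMap.intervalIntegral_comp_comm hint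
  exact h1

theorem isPrincipalLog_Gam_mul_inv {A E : Matrix n n ℝ} {α β : ℂ} {θ₁ θ₂ : ℝ} {ε : ℂ}
    (hθ₁ : θ₁ ∈ Set.Ioo (-Real.pi) Real.pi) (hθ₂ : θ₂ ∈ Set.Ioo (-Real.pi) Real.pi)
    (h : ∀ θ ∈ Set.uIcc θ₁ θ₂, IsUnit (Complex.exp (θ * Complex.I) • Eeps E β ε - Aeps A α ε))
    (Q : Matrix n n ℂ) :
    IsPrincipalLog (Gam A E α β θ₂ ε * (Gam A E α β θ₁ ε)⁻¹) Q ↔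
      Q = eta θ₁ θ₂ • 1 + Complex.I • (Aeps A α ε * integralKeps A E α β θ₁ θ₂ ε) := by
  rw [isPrincipalLog_iff, integralKeps_eq h, Matrix.nonsing_inv_eq_ringInverse]
  exact isPrincipalLogIn_cayleyPencil_mul_inverse hθ₁ hθ₂ h Q

theorem isPrincipalLog_inv_mul_Gam {A E : Matrix n n ℝ} {α β : ℂ} {θ₁ θ₂ : ℝ} {ε : ℂ}
    (hθ₁ : θ₁ ∈ Set.Ioo (-Real.pi) Real.pi) (hθ₂ : θ₂ ∈ Set.Ioo (-Real.pi) Real.pi)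
    (h : ∀ θ ∈ Set.uIcc θ₁ θ₂, IsUnit (Complex.exp (θ * Complex.I) • Eeps E β ε - Aeps A α ε))
    (Q : Matrix n n ℂ) :
    IsPrincipalLog ((Gam A E α β θ₁ ε)⁻¹ * Gam A E α β θ₂ ε) Q ↔
      Q = eta θ₁ θ₂ • 1 + Complex.I • (integralKeps A E α β θ₁ θ₂ ε * Aeps A α ε) := by
  rw [isPrincipalLog_iff, integralKeps_eq h, Matrix.nonsing_inv_eq_ringInverse]
  exact isPrincipalLogIn_inverse_mul_cayleyPencil hθ₁ hθ₂ h Q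

theorem eventually_isUnit_perturbed_pencil {A E : Matrix n n ℝ} (α β : ℂ) {θ₁ θ₂ : ℝ}
    (h : ∀ θ ∈ Set.uIcc θ₁ θ₂, IsUnit (Complex.exp (θ * Complex.I) • toC E - toC A)) :
    ∀ᶠ ε in 𝓝 (0:ℂ), ∀ θ ∈ Set.uIcc θ₁ θ₂,
      IsUnit (Complex.exp (θ * Complex.I) • Eeps E β ε - Aeps A α ε) :=
  eventually_forall_isUnit (f := fun (ε : ℂ) (θ : ℝ) =>
    Complex.exp (θ * Complex.I) • Eeps E β ε - Aeps A α ε)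
    (continuous_perturbed_pencil A E α β) isCompact_uIcc (by simpa [Eeps, Aeps] using h)

theorem tendsto_integralKeps {A E : Matrix n n ℝ} (α β : ℂ) {θ₁ θ₂ : ℝ}
    (h : ∀ θ ∈ Set.uIcc θ₁ θ₂, IsUnit (Complex.exp (θ * Complex.I) • toC E - toC A)) :
    Tendsto (integralKeps A E α β θ₁ θ₂) (𝓝 0) (𝓝 (integralK A E θ₁ θ₂)) := by
  have hev := eventually_isUnit_perturbed_pencil α β h
  have h1 := tendsto_integral_ringInverse (f := fun (ε : ℂ) (θ : ℝ) =>
    Complex.exp (θ * Complex.I) • Eeps E β ε - Aeps A α ε)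
    (continuous_perturbed_pencil A E α β) (x := 0) hev.self_of_nhds
  rw [← integralKeps_zero A E α β, integralKeps_eq hev.self_of_nhds]
  exact h1.congr' (hev.mono fun ε hε => (integralKeps_eq hε).symm)

theorem intervalIntegrable_K_apply {A E : Matrix n n ℝ} {θ₁ θ₂ : ℝ}
    (h : ∀ θ ∈ Set.uIcc θ₁ θ₂, IsUnit (Complex.exp (θ * Complex.I) • toC E - toC A)) (i k : n) :
    IntervalIntegrable (fun θ : ℝ => K A E (Complex.exp (θ * Complex.I)) i k) volume θ₁ θ₂ := by
  have h1 : ContinuousOn (fun θ : ℝ => (Complex.exp (θ * Complex.I) • toC E - toC A)⁻¹ʳ)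
    (Set.uIcc θ₁ θ₂) := continuousOn_ringInverse_comp (by fun_prop) h
  simp only [K, Matrix.nonsing_inv_eq_ringInverse]
  exact ((Matrix.entryLinearMap ℂ ℂ i k).toContinuousLinearMap.continuous.comp_continuousOn
    h1).intervalIntegrable

end Norm

end DescriptorPencil

theorem mainTheorem2 {n : Type*} [Fintype n] [DecidableEq n]
    (A E : Matrix n n ℝ) (α β : ℂ)
    (hreg : IsUnit (α • DescriptorPencil.toC E + β • DescriptorPencil.toC A))
    (θ₁ θ₂ : ℝ)
    (hθ₁ : θ₁ ∈ Set.Ioo (-Real.pi) Real.pi) (hθ₂ : θ₂ ∈ Set.Ioo (-Real.pi) Real.pi)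
    (heig : ∀ φ : ℝ, DescriptorPencil.wrap φ ∈ Set.uIcc θ₁ θ₂ →
      ¬ DescriptorPencil.IsEigenvalue A E (Complex.exp (φ * Complex.I))) :
    -- the integrand is defined on the interval of integration, and the integral exists
    (∀ θ ∈ Set.uIcc θ₁ θ₂,
      IsUnit (Complex.exp (θ * Complex.I) • DescriptorPencil.toC E - DescriptorPencil.toC A)) ∧
    (∀ i k : n, IntervalIntegrable
      (fun θ : ℝ => DescriptorPencil.K A E (Complex.exp (θ * Complex.I)) i k)
      MeasureTheory.volume θ₁ θ₂) ∧
    -- the inverses and the logarithms under the limits are defined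
    (∀ᶠ ε in 𝓝[≠] (0 : ℂ),
      IsUnit (DescriptorPencil.Aeps A α ε) ∧
      IsUnit (DescriptorPencil.Gam A E α β θ₁ ε) ∧
      (∃! Q : Matrix n n ℂ, DescriptorPencil.IsPrincipalLog
        (DescriptorPencil.Gam A E α β θ₂ ε * (DescriptorPencil.Gam A E α β θ₁ ε)⁻¹) Q) ∧
      (∃! Q : Matrix n n ℂ, DescriptorPencil.IsPrincipalLog
        ((DescriptorPencil.Gam A E α β θ₁ ε)⁻¹ * DescriptorPencil.Gam A E α β θ₂ ε) Q)) ∧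
    -- the two formulas
    Tendsto (fun ε : ℂ => (1 / Complex.I) •
        ((DescriptorPencil.Aeps A α ε)⁻¹ *
          (-(DescriptorPencil.eta θ₁ θ₂ • (1 : Matrix n n ℂ)) +
            DescriptorPencil.principalLog
              (DescriptorPencil.Gam A E α β θ₂ ε * (DescriptorPencil.Gam A E α β θ₁ ε)⁻¹))))
      (𝓝[≠] 0) (𝓝 (DescriptorPencil.integralK A E θ₁ θ₂)) ∧
    Tendsto (fun ε : ℂ => (1 / Complex.I) •
        ((-(DescriptorPencil.eta θ₁ θ₂ • (1 : Matrix n n ℂ)) +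
            DescriptorPencil.principalLog
              ((DescriptorPencil.Gam A E α β θ₁ ε)⁻¹ * DescriptorPencil.Gam A E α β θ₂ ε)) *
          (DescriptorPencil.Aeps A α ε)⁻¹))
      (𝓝[≠] 0) (𝓝 (DescriptorPencil.integralK A E θ₁ θ₂)) := by 
  have hsub := DescriptorPencil.uIcc_subset_Ioo hθ₁ hθ₂
  have hR : ∀ θ ∈ Set.uIcc θ₁ θ₂, IsUnit
      (Complex.exp (θ * Complex.I) • DescriptorPencil.toC E - DescriptorPencil.toC A) :=
    fun θ hθ => DescriptorPencil.isUnit_of_not_isEigenvalue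
      (heig θ (by rwa [DescriptorPencil.wrap_eq_self (hsub hθ)]))
  have hP := (DescriptorPencil.eventually_isUnit_perturbed_pencil α β hR).filter_mono
    (nhdsWithin_le_nhds (s := {0}ᶜ))
  have hA := DescriptorPencil.eventually_isUnit_Aeps hreg
  have hlim := (DescriptorPencil.tendsto_integralKeps α β hR).mono_left
    (nhdsWithin_le_nhds (s := {0}ᶜ))
  refine ⟨hR, DescriptorPencil.intervalIntegrable_K_apply hR, ?_, ?_, ?_⟩
  · filter_upwards [hP, hA] with ε hε hAε
    exact ⟨hAε, DescriptorPencil.isUnit_cayleyPencil hθ₁ (hε θ₁ Set.left_mem_uIcc),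
      DescriptorPencil.existsUnique_isPrincipalLog
        (DescriptorPencil.isPrincipalLog_Gam_mul_inv hθ₁ hθ₂ hε),
      DescriptorPencil.existsUnique_isPrincipalLog
        (DescriptorPencil.isPrincipalLog_inv_mul_Gam hθ₁ hθ₂ hε)⟩
  -- For small `ε ≠ 0` the expression under the limit equals the perturbed integral exactly: `η`,
  -- `A_ε` and `j` all cancel.
  · refine hlim.congr' ?_
    filter_upwards [hP, hA] with ε hε hAε
    rw [DescriptorPencil.principalLog_eq
      (DescriptorPencil.isPrincipalLog_Gam_mul_inv hθ₁ hθ₂ hε), neg_add_cancel_left,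
      mul_smul_comm, Matrix.nonsing_inv_mul_cancel_left _ _
        ((Matrix.isUnit_iff_isUnit_det _).1 hAε), smul_smul,
      one_div_mul_cancel Complex.I_ne_zero, one_smul]
  · refine hlim.congr' ?_
    filter_upwards [hP, hA] with ε hε hAε
    rw [DescriptorPencil.principalLog_eq
      (DescriptorPencil.isPrincipalLog_inv_mul_Gam hθ₁ hθ₂ hε), neg_add_cancel_left,
      smul_mul_assoc, Matrix.mul_nonsing_inv_cancel_right _ _
        ((Matrix.isUnit_iff_isUnit_det _).1 hAε), smul_smul,
      one_div_mul_cancel Complex.I_ne_zero, one_smul]
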